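/- Let $k>1$ be an integer, let $\alpha$ be a primitive element of $\mathbb{F}_{2^{2k}}$ (a generator of its multiplicative group), and let $\delta\in\{1,-1\}$. Put $w=2^{2k}-1$ and $N=4w$. Let $\mathbf a=(a_0,a_1,a_2,a_3)=(0,1,1,1)$, with indices modulo $4$; let $b_t=Tr(\alpha^t)$, where $Tr(x)=\sum_{i=0}^{2k-1}x^{2^i}$ is the trace from $\mathbb{F}_{2^{2k}}$ to $\mathbb{F}_2$; and for $0\le c<w$ write $c=i(2^k+1)+j$ with $0\le i\le 2^k-2$, $0\le j\le 2^k$ and let $e_c\in\mathbb{Z}_4$ be $$e_c=\begin{cases}3i+\delta \pmod 4, & j=0,\\ 3(i+j)\pmod 4, & 1\le j\le 2^k.\end{cases}$$ The Yu-Gong sequence $\mathbf s=(s_0,\dots,s_{N-1})$ is the binary sequence of period $N$ with $$s_{rw+c}=a_{r+e_c}+b_c \pmod 2,\qquad 0\le r\le 3,\ 0\le c<w.$$ Its autocorrelation is $AC_{\mathbf s}(\tau)=\sum_{t=0}^{N-1}(-1)^{s_t+s_{t+\tau}}$, with $t+\tau$ computed modulo $N$. Then: (1) If $1\le\tau_1,\tau_2\le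 N-1$ and $\tau_1\equiv\tau_2\pmod{4(2^k+1)}$, then $AC_{\mathbf s}(\tau_1)=AC_{\mathbf s}(\tau_2)$. In particular, $AC_{\mathbf s}(4(2^k+1)i)=-4$ for $i=1,2,\dots,2^k-2$. (2) For $1\le j\le 2^k+1$ let $S_j$ be the ordered quadruple $$S_j=\bigl(AC_{\mathbf s}(4(j-1)+1),\,AC_{\mathbf s}(4(j-1)+2),\,AC_{\mathbf s}(4(j-1)+3),\,AC_{\mathbf s}(4(j-1)+4)\bigr).$$ Then - $S_j=(-4,0,-4,4)$ for $1\le j\le 2^{k-2}$ ($2^{k-2}$ blocks); - $S_{2^{k-2}+1}=(0,0,-4,4)$; - $S_j=(-4,0,-4,4)$ for $2^{k-2}+2\le j\le 3\cdot2^{k-2}$ ($2^{k-1}-1$ blocks); - $S_{3\cdot2^{k-2}+1}=(-4,0,0,4)$; - $S_j=(-4,0,-4,4)$ for $3\cdot2^{k-2}+2\le j\le 2^k$ ($2^{k-2}-1$ blocks, so none when $k=2$); - $S_{2^k+1}=(-4,0,-4,-4)$. -/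

import Mathlib

/-- The autocorrelation at phase shift `τ` of a binary sequence of period `N`
given by its terms `s 0, …, s (N - 1)`; indices are computed modulo `N`. -/
def autocorr (N : ℕ) (s : ℕ → ZMod 2) (τ : ℕ) : ℤ :=
  ∑ t ∈ Finset.range N, (-1 : ℤ) ^ (s t + s ((t + τ) % N)).val

/-- The `(v, w)` interleaved sequence `I(a, e)`, obtained by concatenating the rows of the
`v × w` matrix whose `j`-th column is the cyclic left shift by `e j` of the sequence `a` of
period `v`: the entry in row `i` and column `j` is `a (i + e j)`, and the term with index
`t = i * w + j` (where `j < w`) is that entry. -/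
def interleave (v w : ℕ) (a : ZMod v → ZMod 2) (e : ℕ → ZMod v) (t : ℕ) : ZMod 2 :=
  a (((t / w : ℕ) : ZMod v) + e (t % w))

/-- The perfect binary sequence `(0, 1, 1, 1)` of period `4`. -/
def perfectSeq (i : ZMod 4) : ZMod 2 := if i = 0 then 0 else 1

/-- The binary sequence `b_t = Tr(α ^ t)`, with `Tr` the absolute trace. It is the
`m`-sequence attached to `α` when `α` is a primitive element of the finite field `F`. -/
noncomputable def mSeq {F : Type*} [Field F] [Algebra (ZMod 2) F] (α : F) (t : ℕ) : ZMod 2 :=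
  Algebra.trace (ZMod 2) F (α ^ t)

/-- The entry in row `i` and column `j` (`0 ≤ i ≤ 2 ^ k - 2`, `0 ≤ j ≤ 2 ^ k`) of the matrix
that gives the shift sequence. -/
def shiftMatrix (δ : ℤ) (i j : ℕ) : ZMod 4 :=
  if j = 0 then 3 * (i : ZMod 4) + (δ : ZMod 4) else 3 * ((i : ZMod 4) + (j : ZMod 4))

/-- The shift sequence: the rows of the `(2 ^ k - 1) × (2 ^ k + 1)` matrix, concatenated. -/
def shiftSeq (k : ℕ) (δ : ℤ) (c : ℕ) : ZMod 4 :=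
  shiftMatrix δ (c / (2 ^ k + 1)) (c % (2 ^ k + 1))

/-- The Yu-Gong sequence `I(a, e) + b` of period `4 * (2 ^ (2 * k) - 1)`. -/
noncomputable def yuGong {F : Type*} [Field F] [Algebra (ZMod 2) F] (k : ℕ) (α : F) (δ : ℤ)
    (t : ℕ) : ZMod 2 :=
  interleave 4 (2 ^ (2 * k) - 1) perfectSeq (shiftSeq k δ) t + mSeq α t

/-- The `j`-th block (`j ≥ 1`) of four consecutive values of `A`, in order:
`A (4 (j - 1) + 1), …, A (4 (j - 1) + 4)`. -/
def block (A : ℕ → ℤ) (j : ℕ) : Fin 4 → ℤ :=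
  ![A (4 * (j - 1) + 1), A (4 * (j - 1) + 2), A (4 * (j - 1) + 3), A (4 * (j - 1) + 4)]

open Finset

/-! Put T = 2^k + 1, so T ≡ 1 mod 4. The shift sequence is -t + δ·[T ∣ t] mod 4, and in this form it
absorbs the row index, giving s_t = a(`extShift` t) + Tr(α^t) for every t. Write t = x + T(i + (2^k
- 1)r). Summing over r correlates the perfect sequence with itself, so only columns x with τ ≡ δ([T
∣ x+τ] - [T ∣ x]) mod 4 survive. Summing over i leaves a character sum over the nonzero elements of
the subfield of order 2^k (`autocorr_yuGong_eq_sum`). Over all columns these sums total -1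
(`sum_charSum`). If T ∤ τ, each of the two columns with T ∣ x or T ∣ x+τ contributes -1
(`charSum_subfield`). Hence AC depends only on τ mod 4 and on whether T ∣ τ. -/

/-- The sign `(-1) ^ x` of an element of `ZMod 2`. -/
def binSign (x : ZMod 2) : ℤ := (-1) ^ x.val

lemma binSign_add (x y : ZMod 2) : binSign (x + y) = binSign x * binSign y := by
  revert x y; decide

lemma sum_perfectSeq_correlation (c d : ZMod 4) :
    ∑ r ∈ range 4, binSign (perfectSeq (c + (r : ZMod 4)) + perfectSeq (d + (r : ZMod 4))) =
      if c = d then 4 else 0 := by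
  revert c d; decide

/-! ### Closed form of the shift sequence -/

/-- The shift sequence, extended to all indices so that the Yu-Gong sequence is
`a (extShift k δ t) + b t`. -/
def extShift (k : ℕ) (δ : ℤ) (t : ℕ) : ZMod 4 :=
  -(t : ZMod 4) + if 2 ^ k + 1 ∣ t then (δ : ZMod 4) else 0

lemma two_pow_cast_zmod_four {k : ℕ} (hk : 1 < k) : ((2 ^ k : ℕ) : ZMod 4) = 0 := by
  rw [ZMod.natCast_eq_zero_iff]
  exact pow_dvd_pow 2 hk

lemma two_pow_two_mul_sub_one (k : ℕ) :
    2 ^ (2 * k) - 1 = (2 ^ k + 1) * (2 ^ k - 1) := by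
  rw [mul_comm 2 k, pow_mul, ← Nat.sq_sub_sq, one_pow]

lemma two_pow_sub_one_cast_zmod_four {k : ℕ} (hk : 1 < k) :
    ((2 ^ k - 1 : ℕ) : ZMod 4) = -1 := by
  rw [Nat.cast_sub Nat.one_le_two_pow, two_pow_cast_zmod_four hk]
  simp

lemma extShift_add_period_mul {k : ℕ} (hk : 1 < k) (δ : ℤ) (t i : ℕ) :
    extShift k δ (t + (2 ^ k + 1) * i) = extShift k δ t - (i : ZMod 4) := by
  have h := two_pow_cast_zmod_four hk
  simp only [extShift, Nat.dvd_add_left (dvd_mul_right _ _)]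
  push_cast at h ⊢
  rw [h]; ring

lemma shiftSeq_eq_extShift {k : ℕ} (hk : 1 < k) (δ : ℤ) (c : ℕ) :
    shiftSeq k δ c = extShift k δ c := by
  have h3 : (3 : ZMod 4) = -1 := by decide
  conv_rhs => rw [← Nat.mod_add_div c (2 ^ k + 1), extShift_add_period_mul hk]
  have hlt : c % (2 ^ k + 1) < 2 ^ k + 1 := Nat.mod_lt _ (by positivity)
  by_cases h0 : c % (2 ^ k + 1) = 0
  · simp only [shiftSeq, shiftMatrix, extShift, h0, h3]
    simp; ring
  · have : ¬ 2 ^ k + 1 ∣ c % (2 ^ k + 1) :=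
      Nat.not_dvd_of_pos_of_lt (Nat.pos_of_ne_zero h0) hlt
    simp only [shiftSeq, shiftMatrix, extShift, h0, h3, this]
    simp; ring

section Field

variable {F : Type*} [Field F] [Algebra (ZMod 2) F]

/-- The row length is T(2^k - 1) with 2^k - 1 ≡ -1 mod 4, so passing to the next row raises
`extShift` by 1, exactly as the row index does. -/
lemma yuGong_eq {k : ℕ} (hk : 1 < k) (α : F) (δ : ℤ) (t : ℕ) :
    yuGong k α δ t = perfectSeq (extShift k δ t) + mSeq α t := by
  rw [yuGong, interleave, shiftSeq_eq_extShift hk]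
  congr 2
  conv_rhs => rw [← Nat.mod_add_div t (2 ^ (2 * k) - 1), two_pow_two_mul_sub_one, mul_assoc,
    extShift_add_period_mul hk, Nat.cast_mul, two_pow_sub_one_cast_zmod_four hk]
  rw [two_pow_two_mul_sub_one]
  ring

lemma yuGong_mod {k : ℕ} (hk : 1 < k) {α : F} (hα : IsPrimitiveRoot α (2 ^ (2 * k) - 1))
    (δ : ℤ) (t : ℕ) :
    yuGong k α δ (t % (4 * (2 ^ (2 * k) - 1))) = yuGong k α δ t := by
  have h4 : (4 : ZMod 4) = 0 := by decide
  conv_rhs => rw [← Nat.mod_add_div t (4 * (2 ^ (2 * k) - 1))]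
  rw [yuGong_eq hk, yuGong_eq hk]
  set c := t % (4 * (2 ^ (2 * k) - 1))
  set d := t / (4 * (2 ^ (2 * k) - 1))
  congr 1
  · congr 1
    rw [two_pow_two_mul_sub_one, show 4 * ((2 ^ k + 1) * (2 ^ k - 1)) * d =
      (2 ^ k + 1) * (4 * ((2 ^ k - 1) * d)) by ring, extShift_add_period_mul hk]
    push_cast
    rw [h4]; ring
  · rw [mSeq, mSeq, pow_add, mul_comm 4, mul_assoc, pow_mul, hα.pow_eq_one, one_pow, mul_one]

/-! ### Character sums -/

/-- The sum of the additive character `(-1) ^ Tr` over `y` times the powers of `γ`. -/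
noncomputable def charSum (n : ℕ) (γ y : F) : ℤ :=
  ∑ i ∈ range n, binSign (Algebra.trace (ZMod 2) F (y * γ ^ i))

lemma sum_range_mul_eq {M : Type*} [AddCommMonoid M] (f : ℕ → M) (a b : ℕ) :
    ∑ t ∈ range (a * b), f t = ∑ x ∈ range a, ∑ i ∈ range b, f (x + a * i) := by
  induction b with
  | zero => simp
  | succ b ih =>
    rw [Nat.mul_succ, sum_range_add, ih, ← sum_add_distrib]
    refine sum_congr rfl fun x _ => ?_
    rw [sum_range_succ, add_comm x]

lemma autocorr_yuGong_eq_sum {k : ℕ} (hk : 1 < k) {α : F}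
    (hα : IsPrimitiveRoot α (2 ^ (2 * k) - 1)) (δ : ℤ) (τ : ℕ) :
    autocorr (4 * (2 ^ (2 * k) - 1)) (yuGong k α δ) τ =
      4 * ∑ x ∈ range (2 ^ k + 1), if extShift k δ x = extShift k δ (x + τ) then
        charSum (2 ^ k - 1) (α ^ (2 ^ k + 1)) (α ^ x * (1 + α ^ τ)) else 0 := by
  have key : ∀ t : ℕ, yuGong k α δ t + yuGong k α δ ((t + τ) % (4 * (2 ^ (2 * k) - 1))) =
      (perfectSeq (extShift k δ t) + perfectSeq (extShift k δ (t + τ))) +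
        Algebra.trace (ZMod 2) F (α ^ t * (1 + α ^ τ)) := by
    intro t
    rw [yuGong_mod hk hα, yuGong_eq hk, yuGong_eq hk, mSeq, mSeq, mul_add, mul_one, ← pow_add,
      map_add]
    ring
  have hN : 4 * (2 ^ (2 * k) - 1) = (2 ^ k + 1) * ((2 ^ k - 1) * 4) := by
    rw [two_pow_two_mul_sub_one]; ring
  have hγ : (α ^ (2 ^ k + 1)) ^ (2 ^ k - 1) = 1 := by
    rw [← pow_mul, ← two_pow_two_mul_sub_one, hα.pow_eq_one]
  change ∑ t ∈ range (4 * (2 ^ (2 * k) - 1)), binSign _ = _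
  simp_rw [key]
  rw [hN, sum_range_mul_eq, mul_sum]
  refine sum_congr rfl fun x _ => ?_
  rw [sum_range_mul_eq]
  -- Changing `r` moves both shifts by `r` and fixes the power of α; changing `i` moves both shifts
  -- equally, so their agreement depends on `x` alone.
  have inner : ∀ i ∈ range (2 ^ k - 1), ∑ r ∈ range 4,
      binSign (perfectSeq (extShift k δ (x + (2 ^ k + 1) * (i + (2 ^ k - 1) * r))) +
        perfectSeq (extShift k δ (x + (2 ^ k + 1) * (i + (2 ^ k - 1) * r) + τ)) +
        Algebra.trace (ZMod 2) F
          (α ^ (x + (2 ^ k + 1) * (i + (2 ^ k - 1) * r)) * (1 + α ^ τ))) =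
      4 * if extShift k δ x = extShift k δ (x + τ) then
        binSign (Algebra.trace (ZMod 2) F (α ^ x * (1 + α ^ τ) * (α ^ (2 ^ k + 1)) ^ i))
        else 0 := by
    intro i _
    have e : ∀ y r : ℕ, extShift k δ (y + (2 ^ k + 1) * (i + (2 ^ k - 1) * r)) =
        extShift k δ y - i + r := by
      intro y r
      rw [extShift_add_period_mul hk, Nat.cast_add, Nat.cast_mul,
        two_pow_sub_one_cast_zmod_four hk]
      ring
    have g : ∀ r : ℕ, α ^ (x + (2 ^ k + 1) * (i + (2 ^ k - 1) * r)) * (1 + α ^ τ) =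
        α ^ x * (1 + α ^ τ) * (α ^ (2 ^ k + 1)) ^ i := by
      intro r
      rw [pow_add, pow_mul α, pow_add (α ^ (2 ^ k + 1)), pow_mul (α ^ (2 ^ k + 1)), hγ, one_pow]
      ring
    simp_rw [add_right_comm x _ τ, e, g, binSign_add _ (Algebra.trace (ZMod 2) F _)]
    rw [← sum_mul, sum_perfectSeq_correlation]
    simp only [sub_left_inj]
    split_ifs <;> ring
  rw [sum_congr rfl inner, ← mul_sum]
  split_ifs
  · rfl
  · simp

omit [Algebra (ZMod 2) F] in
lemma sum_range_pow_primitiveRoot {M : Type*} [AddCommMonoid M] [Fintype F] [DecidableEq F]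
    {n : ℕ} [NeZero n] {ζ : F} (hζ : IsPrimitiveRoot ζ n) (f : F → M) :
    ∑ i ∈ range n, f (ζ ^ i) = ∑ x with x ^ n = 1, f x := by
  rw [← sum_image (f := f) (g := fun i => ζ ^ i) (s := range n)]
  · congr 1
    ext x
    simp only [mem_image, mem_range, mem_filter, mem_univ, true_and]
    constructor
    · rintro ⟨i, _, rfl⟩
      rw [← pow_mul, mul_comm, pow_mul, hζ.pow_eq_one, one_pow]
    · exact fun h => hζ.eq_pow_of_pow_eq_one h
  · intro i hi j hj h
    exact hζ.pow_inj (by simpa using hi) (by simpa using hj) h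

/-- Translation by `x₀` permutes the roots of x^(2^m) = x and flips every sign, so the sum over them
vanishes; the root 0 accounts for 1. -/
lemma charSum_eq_neg_one [Finite F] {m : ℕ} (hm : m ≠ 0) {ζ : F}
    (hζ : IsPrimitiveRoot ζ (2 ^ m - 1)) {x₀ y : F} (hx₀ : x₀ ^ 2 ^ m = x₀)
    (hy : Algebra.trace (ZMod 2) F (y * x₀) ≠ 0) : charSum (2 ^ m - 1) ζ y = -1 := by
  classical
  have := Fintype.ofFinite F
  have : CharP F 2 := charP_of_injective_algebraMap (algebraMap (ZMod 2) F).injective 2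
  have h2 : 2 ≤ 2 ^ m := by simpa using Nat.pow_le_pow_right two_pos (Nat.one_le_iff_ne_zero.2 hm)
  have : NeZero (2 ^ m - 1) := ⟨by omega⟩
  have hone : Algebra.trace (ZMod 2) F (y * x₀) = 1 := by
    generalize Algebra.trace (ZMod 2) F (y * x₀) = z at hy
    revert z; decide
  set f : F → ℤ := fun x => binSign (Algebra.trace (ZMod 2) F (y * x)) with hf
  set K : Finset F := univ.filter fun x => x ^ 2 ^ m = x with hK
  have hsplit : K = insert 0 (univ.filter fun x : F => x ^ (2 ^ m - 1) = 1) := by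
    ext x
    simp only [hK, mem_filter, mem_univ, true_and, mem_insert]
    have : x ^ 2 ^ m = x ^ (2 ^ m - 1) * x := by rw [← pow_succ]; congr 1; omega
    rw [this]
    rcases eq_or_ne x 0 with rfl | hx
    · simp
    · simp [hx]
  have hflip : ∀ x, f (x + x₀) = - f x := by
    intro x
    simp only [hf, mul_add, map_add, binSign_add, hone]
    have : binSign 1 = -1 := by decide
    rw [this]; ring
  have hsum : ∑ x ∈ K, f x = 0 := by
    have h : ∑ x ∈ K, f (x + x₀) = ∑ x ∈ K, f x := by
      refine sum_bij' (fun x _ => x + x₀) (fun x _ => x + x₀) ?_ ?_ ?_ ?_ ?_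
      · intro x hx
        simp only [hK, mem_filter, mem_univ, true_and] at hx ⊢
        rw [add_pow_char_pow, hx, hx₀]
      · intro x hx
        simp only [hK, mem_filter, mem_univ, true_and] at hx ⊢
        rw [add_pow_char_pow, hx, hx₀]
      · intro x _; rw [add_assoc, CharTwo.add_self_eq_zero, add_zero]
      · intro x _; rw [add_assoc, CharTwo.add_self_eq_zero, add_zero]
      · intro x _; rfl
    simp only [hflip, sum_neg_distrib] at h
    omega
  rw [hsplit, sum_insert (by simp [(NeZero.ne (2 ^ m - 1))])] at hsum
  have h0 : f 0 = 1 := by simp [hf, binSign]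
  rw [charSum, sum_range_pow_primitiveRoot hζ f]
  omega

/-- The 2k conjugates form two identical halves, which cancel in characteristic 2. -/
lemma trace_eq_zero_of_pow_eq {k : ℕ} (hF : Nat.card F = 2 ^ (2 * k)) {z : F}
    (hz : z ^ 2 ^ k = z) : Algebra.trace (ZMod 2) F z = 0 := by
  have : Finite F := Nat.finite_of_card_ne_zero (by rw [hF]; positivity)
  have : CharP F 2 := charP_of_injective_algebraMap (algebraMap (ZMod 2) F).injective 2
  have hfr : Module.finrank (ZMod 2) F = k + k := by
    have := Module.natCard_eq_pow_finrank (K := ZMod 2) (V := F)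
    rw [hF, Nat.card_zmod] at this
    have := Nat.pow_right_injective le_rfl this
    omega
  apply (algebraMap (ZMod 2) F).injective
  rw [FiniteField.algebraMap_trace_eq_sum_pow, hfr, sum_range_add, map_zero]
  simp only [Nat.card_zmod, pow_add, pow_mul, hz]
  exact CharTwo.add_self_eq_zero _

lemma exists_trace_ne_zero_of_pow_ne {k : ℕ} (hF : Nat.card F = 2 ^ (2 * k)) {y : F}
    (hy : y ^ 2 ^ k ≠ y) : ∃ x : F, x ^ 2 ^ k = x ∧ Algebra.trace (ZMod 2) F (y * x) ≠ 0 := by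
  have : Finite F := Nat.finite_of_card_ne_zero (by rw [hF]; positivity)
  have := Fintype.ofFinite F
  have : CharP F 2 := charP_of_injective_algebraMap (algebraMap (ZMod 2) F).injective 2
  have hinv : ∀ z : F, (z ^ 2 ^ k) ^ 2 ^ k = z := by
    intro z
    rw [← pow_mul, ← pow_add, ← two_mul, ← hF, Nat.card_eq_fintype_card, FiniteField.pow_card]
  have hne : y + y ^ 2 ^ k ≠ 0 := fun h => hy (CharTwo.add_eq_zero.1 h).symm
  obtain ⟨z, hz⟩ := Algebra.trace_surjective (ZMod 2) F 1
  -- Chosen so that `z + y * b` is fixed by x ↦ x^(2^k). Its trace is then 0, while `z` has trace 1.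
  set b := (z + z ^ 2 ^ k) / (y + y ^ 2 ^ k) with hb
  have hbK : b ^ 2 ^ k = b := by
    rw [hb, div_pow, add_pow_char_pow, add_pow_char_pow, hinv, hinv, add_comm z, add_comm y]
  refine ⟨b, hbK, fun h => ?_⟩
  have haK : (z + y * b) ^ 2 ^ k = z + y * b := by
    rw [add_pow_char_pow, mul_pow, hbK]
    have : (y + y ^ 2 ^ k) * b = z + z ^ 2 ^ k := by rw [hb]; field_simp
    refine (CharTwo.add_eq_zero.1 ?_)
    calc z ^ 2 ^ k + y ^ 2 ^ k * b + (z + y * b)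
        = (z + z ^ 2 ^ k) + (y + y ^ 2 ^ k) * b := by ring
      _ = 0 := by rw [this]; exact CharTwo.add_self_eq_zero _
  have h1 := trace_eq_zero_of_pow_eq hF haK
  rw [map_add, h, hz, add_zero] at h1
  exact one_ne_zero h1

lemma charSum_subfield {k : ℕ} (hk : 1 < k) (hF : Nat.card F = 2 ^ (2 * k)) {α : F}
    (hα : IsPrimitiveRoot α (2 ^ (2 * k) - 1)) {y : F} (hy : y ^ 2 ^ k ≠ y) :
    charSum (2 ^ k - 1) (α ^ (2 ^ k + 1)) y = -1 := by
  have : Finite F := Nat.finite_of_card_ne_zero (by rw [hF]; positivity)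
  obtain ⟨x, hx, hxy⟩ := exists_trace_ne_zero_of_pow_ne hF hy
  refine charSum_eq_neg_one (by omega) (hα.pow ?_ (two_pow_two_mul_sub_one k)) hx hxy
  have := Nat.pow_le_pow_right two_pos (show 1 ≤ 2 * k by omega)
  omega

lemma sum_charSum {k : ℕ} (hk : 1 < k) (hF : Nat.card F = 2 ^ (2 * k)) {α : F}
    (hα : IsPrimitiveRoot α (2 ^ (2 * k) - 1)) {β : F} (hβ : β ≠ 0) :
    ∑ x ∈ range (2 ^ k + 1), charSum (2 ^ k - 1) (α ^ (2 ^ k + 1)) (α ^ x * β) = -1 := by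
  have : Finite F := Nat.finite_of_card_ne_zero (by rw [hF]; positivity)
  have := Fintype.ofFinite F
  obtain ⟨z, hz⟩ := Algebra.trace_surjective (ZMod 2) F 1
  have h : charSum (2 ^ (2 * k) - 1) α β = -1 := by
    refine charSum_eq_neg_one (x₀ := β⁻¹ * z) (by omega) hα ?_ ?_
    · rw [← hF, Nat.card_eq_fintype_card, FiniteField.pow_card]
    · rw [mul_inv_cancel_left₀ hβ, hz]; exact one_ne_zero
  rw [← h, charSum, two_pow_two_mul_sub_one, sum_range_mul_eq]
  refine sum_congr rfl fun x _ => sum_congr rfl fun i _ => ?_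
  rw [pow_add α x, pow_mul α]
  congr 2; ring

omit [Algebra (ZMod 2) F] in
lemma pow_mem_subfield_iff {k : ℕ} {α : F} (hk : 1 < k)
    (hα : IsPrimitiveRoot α (2 ^ (2 * k) - 1)) (n : ℕ) :
    (α ^ n) ^ 2 ^ k = α ^ n ↔ 2 ^ k + 1 ∣ n := by
  have h4 : 4 ≤ 2 ^ k := Nat.pow_le_pow_right two_pos hk
  have h0 : α ≠ 0 := hα.ne_zero (by
    rw [two_pow_two_mul_sub_one]; exact mul_ne_zero (by omega) (by omega))
  have h : (α ^ n) ^ 2 ^ k = α ^ (n * (2 ^ k - 1)) * α ^ n := by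
    rw [← pow_mul, ← pow_add]
    congr 1
    rw [Nat.mul_sub, mul_one, Nat.sub_add_cancel (Nat.le_mul_of_pos_right _ (by omega))]
  rw [h, mul_eq_right₀ (pow_ne_zero _ h0), hα.pow_eq_one_iff_dvd, two_pow_two_mul_sub_one,
    Nat.mul_dvd_mul_iff_right (by omega)]

lemma sum_range_ite_dvd_add (T : ℕ) (hT : 0 < T) (τ : ℕ) :
    ∑ x ∈ range T, (if T ∣ x + τ then (1 : ℤ) else 0) = 1 := by
  have hlt := Nat.mod_lt τ hT
  have hdvd : ∀ x, T ∣ x + τ ↔ T ∣ x + τ % T := fun x => by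
    rw [Nat.dvd_iff_mod_eq_zero, Nat.dvd_iff_mod_eq_zero, Nat.add_mod_mod]
  simp only [hdvd]
  generalize τ % T = v at hlt
  rcases Nat.eq_zero_or_pos v with rfl | hv
  · rw [sum_eq_single 0]
    · simp
    · intro x hx h0
      rw [if_neg (Nat.not_dvd_of_pos_of_lt (by omega) (by simpa using hx))]
    · simp [hT.ne']
  · rw [sum_eq_single (T - v)]
    · rw [if_pos]; rw [Nat.sub_add_cancel hlt.le]
    · intro x hx h0
      rw [mem_range] at hx
      rw [if_neg]
      rintro ⟨c, hc⟩
      have h1 : c < 2 := by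
        by_contra h
        have := Nat.mul_le_mul_left T (not_lt.1 h)
        omega
      interval_cases c <;> omega
    · intro h; simp at h; omega

/-! ### Evaluation of the autocorrelation -/

/-- The autocorrelation of the Yu-Gong sequence at every nonzero phase shift. -/
theorem autocorr_yuGong {k : ℕ} (hk : 1 < k) (hF : Nat.card F = 2 ^ (2 * k)) {α : F}
    (hα : IsPrimitiveRoot α (2 ^ (2 * k) - 1)) {δ : ℤ} (hδ : δ = 1 ∨ δ = -1) {τ : ℕ}
    (hτ : 1 ≤ τ) (hτN : τ ≤ 4 * (2 ^ (2 * k) - 1) - 1) :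
    autocorr (4 * (2 ^ (2 * k) - 1)) (yuGong k α δ) τ =
      if 2 ^ k + 1 ∣ τ then (if τ % 4 = 0 then -4 else 0)
      else if τ % 4 = 0 then 4 else if τ % 4 = 2 then 0 else -4 := by
  have : CharP F 2 := charP_of_injective_algebraMap (algebraMap (ZMod 2) F).injective 2
  have h4 : 4 ≤ 2 ^ k := Nat.pow_le_pow_right two_pos hk
  have hcast : ((τ % 4 : ℕ) : ZMod 4) = τ := ZMod.natCast_mod τ 4
  have hmod := Nat.mod_lt τ (show 0 < 4 by norm_num)
  have hcond : ∀ x : ℕ, extShift k δ x = extShift k δ (x + τ) ↔ (τ : ZMod 4) =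
      (if 2 ^ k + 1 ∣ x + τ then (δ : ZMod 4) else 0) -
        if 2 ^ k + 1 ∣ x then (δ : ZMod 4) else 0 := by
    intro x
    simp only [extShift]
    push_cast
    constructor <;> intro h <;> linear_combination h
  rw [autocorr_yuGong_eq_sum hk hα]
  simp only [hcond]
  by_cases hT : 2 ^ k + 1 ∣ τ
  · rw [if_pos hT]
    simp only [Nat.dvd_add_left hT, sub_self]
    by_cases h0 : τ % 4 = 0
    · have : (τ : ZMod 4) = 0 := by rw [← hcast, h0]; rfl
      simp only [this, h0, if_true]
      rw [sum_charSum hk hF hα]; · rfl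
      intro hβ
      have h1 : α ^ τ = 1 := (CharTwo.add_eq_zero.1 hβ).symm
      rw [hα.pow_eq_one_iff_dvd] at h1
      -- The order of α is odd, so α^τ = 1 together with 4 ∣ τ would make τ a multiple of the full
      -- period.
      have hw : (2 ^ (2 * k) - 1) % 4 = 3 := by
        have : 2 ^ (2 * k) = 4 * 2 ^ (2 * k - 2) := by
          rw [show (4 : ℕ) = 2 ^ 2 by rfl, ← pow_add]; congr 1; omega
        have : 0 < 2 ^ (2 * k - 2) := by positivity
        omega
      obtain ⟨c, rfl⟩ := h1
      generalize 2 ^ (2 * k) - 1 = w at *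
      have hc : c < 4 := by
        by_contra h
        have := Nat.mul_le_mul_left w (not_lt.1 h)
        omega
      interval_cases c <;> omega
    · have : (τ : ZMod 4) ≠ 0 := by
        rw [Ne, ZMod.natCast_eq_zero_iff]; omega
      simp [this, h0]
  · rw [if_neg hT]
    have hαT := fun n => pow_mem_subfield_iff hk hα n
    have hw4 : 2 ^ k + 1 ∣ 2 ^ (2 * k) - 1 := by
      rw [two_pow_two_mul_sub_one]; exact dvd_mul_right _ _
    have hβ : 1 + α ^ τ ≠ 0 := by
      intro h
      have h1 : α ^ τ = 1 := (CharTwo.add_eq_zero.1 h).symm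
      rw [hα.pow_eq_one_iff_dvd] at h1
      exact hT (hw4.trans h1)
    -- Exactly one of α^x and α^(x+τ) lies in the subfield, so their sum does not.
    have hS : ∀ x, 2 ^ k + 1 ∣ x ∨ 2 ^ k + 1 ∣ x + τ →
        charSum (2 ^ k - 1) (α ^ (2 ^ k + 1)) (α ^ x * (1 + α ^ τ)) = -1 := by
      intro x hx
      refine charSum_subfield hk hF hα fun h => ?_
      rw [mul_add, mul_one, ← pow_add, add_pow_char_pow] at h
      rcases hx with hx | hx
      · rw [(hαT x).2 hx, add_right_inj, hαT, Nat.dvd_add_right hx] at h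
        exact hT h
      · rw [(hαT (x + τ)).2 hx, add_left_inj, hαT] at h
        exact hT ((Nat.dvd_add_right h).1 hx)
    set A : ℤ := if (τ : ZMod 4) = 0 then 1 else 0 with hA
    set B : ℤ := if (τ : ZMod 4) = δ then 1 else 0 with hB
    set C : ℤ := if (τ : ZMod 4) = -δ then 1 else 0 with hC
    -- Start from the generic weight `A` in every column, then correct the two exceptional ones,
    -- where the sum is -1. Writing `x + 0` lets `sum_range_ite_dvd_add` count both.
    have hterm : ∀ x ∈ range (2 ^ k + 1), (if (τ : ZMod 4) =
        (if 2 ^ k + 1 ∣ x + τ then (δ : ZMod 4) else 0) -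
          (if 2 ^ k + 1 ∣ x then (δ : ZMod 4) else 0) then
        charSum (2 ^ k - 1) (α ^ (2 ^ k + 1)) (α ^ x * (1 + α ^ τ)) else 0) =
        A * charSum (2 ^ k - 1) (α ^ (2 ^ k + 1)) (α ^ x * (1 + α ^ τ)) +
          (A - C) * (if 2 ^ k + 1 ∣ x + 0 then 1 else 0) +
          (A - B) * (if 2 ^ k + 1 ∣ x + τ then 1 else 0) := by
      intro x _
      rw [add_zero]
      by_cases h1 : 2 ^ k + 1 ∣ x
      · have h2 : ¬ 2 ^ k + 1 ∣ x + τ := fun h => hT ((Nat.dvd_add_right h1).1 h)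
        simp only [h1, h2, hS x (Or.inl h1), if_true, if_false, zero_sub, hC]
        split_ifs <;> ring
      · by_cases h2 : 2 ^ k + 1 ∣ x + τ
        · simp only [h1, h2, hS x (Or.inr h2), if_true, if_false, sub_zero, hB]
          split_ifs <;> ring
        · simp only [h1, h2, if_false, sub_zero, hA]
          split_ifs <;> ring
    rw [sum_congr rfl hterm, sum_add_distrib, sum_add_distrib, ← mul_sum, ← mul_sum, ← mul_sum,
      sum_charSum hk hF hα hβ, sum_range_ite_dvd_add _ (by omega),
      sum_range_ite_dvd_add _ (by omega), hA, hB, hC, ← hcast]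
    generalize τ % 4 = r at hmod
    rcases hδ with rfl | rfl <;> interval_cases r <;> decide

end Field

/-! ### Reading off the blocks -/

lemma eq_mul_of_dvd_of_le_four_mul {T n : ℕ} (hn : 1 ≤ n) (hle : n ≤ 4 * T) (h : T ∣ n) :
    n = T ∨ n = 2 * T ∨ n = 3 * T ∨ n = 4 * T := by
  obtain ⟨c, rfl⟩ := h
  have hT : 0 < T := Nat.pos_of_mul_pos_right hn
  have hc : c ≤ 4 := Nat.le_of_mul_le_mul_left (by linarith) hT
  interval_cases c <;> omega

/-- With T = 4p + 1, the multiple cT is entry c of block cp + 1 for c = 1, …, 4. The case c = 2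
leaves no trace, as the value there is 0 either way. -/
lemma block_eq {A : ℕ → ℤ} {p j : ℕ} (hj : 1 ≤ j) (hjp : j ≤ 4 * p + 1)
    (hA : ∀ τ, 1 ≤ τ → τ ≤ 4 * (4 * p + 1) → A τ =
      if 4 * p + 1 ∣ τ then (if τ % 4 = 0 then -4 else 0)
      else if τ % 4 = 0 then 4 else if τ % 4 = 2 then 0 else -4) :
    block A j = ![if j = p + 1 then 0 else -4, 0, if j = 3 * p + 1 then 0 else -4,
      if j = 4 * p + 1 then -4 else 4] := by
  have hdvd : ∀ n, 1 ≤ n → n ≤ 4 * (4 * p + 1) → (4 * p + 1 ∣ n ↔ n = 4 * p + 1 ∨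
      n = 2 * (4 * p + 1) ∨ n = 3 * (4 * p + 1) ∨ n = 4 * (4 * p + 1)) := by
    refine fun n hn hle => ⟨eq_mul_of_dvd_of_le_four_mul hn hle, ?_⟩
    rintro (rfl | rfl | rfl | rfl)
    · exact dvd_rfl
    all_goals exact dvd_mul_left _ _
  have h : ∀ n, 1 ≤ n → n ≤ 4 * (4 * p + 1) → A n =
      if n = 4 * p + 1 ∨ n = 2 * (4 * p + 1) ∨ n = 3 * (4 * p + 1) ∨ n = 4 * (4 * p + 1) then
        (if n % 4 = 0 then -4 else 0)
      else if n % 4 = 0 then 4 else if n % 4 = 2 then 0 else -4 := by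
    intro n h1 h2
    rw [hA n h1 h2]
    simp only [hdvd n h1 h2]
  rw [block, h _ (by omega) (by omega), h _ (by omega) (by omega), h _ (by omega) (by omega),
    h _ (by omega) (by omega)]
  congr 1
  · split_ifs <;> omega
  congr 1
  · split_ifs <;> omega
  congr 1
  · split_ifs <;> omega
  congr 1
  split_ifs <;> omega

theorem mainTheorem2 (k : ℕ) (hk : 1 < k)
    {F : Type*} [Field F] [Algebra (ZMod 2) F] (hF : Nat.card F = 2 ^ (2 * k))
    (α : F) (hα : IsPrimitiveRoot α (2 ^ (2 * k) - 1))
    (δ : ℤ) (hδ : δ = 1 ∨ δ = -1)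
    (N : ℕ) (hN : N = 4 * (2 ^ (2 * k) - 1))
    (AC : ℕ → ℤ) (hAC : AC = autocorr N (yuGong k α δ)) :
    ((∀ τ₁ τ₂ : ℕ, 1 ≤ τ₁ → τ₁ ≤ N - 1 → 1 ≤ τ₂ → τ₂ ≤ N - 1 →
        τ₁ ≡ τ₂ [MOD 4 * (2 ^ k + 1)] → AC τ₁ = AC τ₂) ∧
      (∀ i : ℕ, 1 ≤ i → i ≤ 2 ^ k - 2 → AC (4 * (2 ^ k + 1) * i) = -4)) ∧
    ((∀ j ∈ Finset.Icc 1 (2 ^ (k - 2)), block AC j = ![-4, 0, -4, 4]) ∧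
      block AC (2 ^ (k - 2) + 1) = ![0, 0, -4, 4] ∧
      (∀ j ∈ Finset.Icc (2 ^ (k - 2) + 2) (3 * 2 ^ (k - 2)), block AC j = ![-4, 0, -4, 4]) ∧
      block AC (3 * 2 ^ (k - 2) + 1) = ![-4, 0, 0, 4] ∧
      (∀ j ∈ Finset.Icc (3 * 2 ^ (k - 2) + 2) (2 ^ k), block AC j = ![-4, 0, -4, 4]) ∧
      block AC (2 ^ k + 1) = ![-4, 0, -4, -4]) ∧
    ((Finset.Icc 1 (2 ^ (k - 2))).card = 2 ^ (k - 2) ∧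
      (Finset.Icc (2 ^ (k - 2) + 2) (3 * 2 ^ (k - 2))).card = 2 ^ (k - 1) - 1 ∧
      (Finset.Icc (3 * 2 ^ (k - 2) + 2) (2 ^ k)).card = 2 ^ (k - 2) - 1) := by
  have h4 : 4 ≤ 2 ^ k := Nat.pow_le_pow_right two_pos hk
  have hw := two_pow_two_mul_sub_one k
  subst hN hAC
  have hA := fun τ h1 h2 => autocorr_yuGong hk hF hα hδ (τ := τ) h1 h2
  generalize autocorr _ (yuGong k α δ) = A at hA
  have hk1 : 2 ^ (k - 1) = 2 * 2 ^ (k - 2) := by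
    rw [← pow_succ']; congr 1; omega
  have hk2 : 2 ^ k = 4 * 2 ^ (k - 2) := by
    rw [show (4 : ℕ) = 2 ^ 2 by rfl, ← pow_add]; congr 1; omega
  have hp : 0 < 2 ^ (k - 2) := by positivity
  rw [hk1]
  rw [hw] at hA ⊢
  rw [hk2] at hA h4 ⊢
  generalize 2 ^ (k - 2) = p at hA h4 hp ⊢
  -- All blocks lie within 1 ≤ τ ≤ N - 1, since 2^k - 1 ≥ 3.
  have hN : 4 * (4 * p + 1) ≤ 4 * ((4 * p + 1) * (4 * p - 1)) - 1 := by
    have := Nat.mul_le_mul_left (4 * p + 1) (show 3 ≤ 4 * p - 1 by omega)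
    omega
  have hB := fun j h1 h2 => block_eq (A := A) (p := p) (j := j) h1 h2
    fun τ h3 h4 => hA τ h3 (h4.trans hN)
  refine ⟨⟨fun τ₁ τ₂ h1 h2 h3 h4 h => ?_, fun i h1 h2 => ?_⟩,
    ⟨fun j hj => ?_, ?_, fun j hj => ?_, ?_, fun j hj => ?_, ?_⟩, ?_, ?_, ?_⟩
  · have e1 : τ₁ % 4 = τ₂ % 4 := h.of_mul_right _
    have e2 := (h.of_mul_left 4).dvd_iff (dvd_refl (4 * p + 1))
    rw [hA _ h1 h2, hA _ h3 h4, e1]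
    simp only [e2]
  · have h0 : 0 < (4 * p + 1) * i := by positivity
    have hlt := Nat.mul_lt_mul_of_pos_left (show i < 4 * p - 1 by omega)
      (show 0 < 4 * p + 1 by omega)
    rw [hA _ (by rw [mul_assoc]; omega) (by rw [mul_assoc]; omega),
      if_pos ((dvd_mul_left _ _).mul_right _), if_pos (by rw [mul_assoc]; omega)]
  · rw [mem_Icc] at hj
    rw [hB j (by omega) (by omega), if_neg (by omega), if_neg (by omega), if_neg (by omega)]
  · rw [hB _ (by omega) (by omega), if_pos (by omega), if_neg (by omega), if_neg (by omega)]
  · rw [mem_Icc] at hj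
    rw [hB j (by omega) (by omega), if_neg (by omega), if_neg (by omega), if_neg (by omega)]
  · rw [hB _ (by omega) (by omega), if_neg (by omega), if_pos (by omega), if_neg (by omega)]
  · rw [mem_Icc] at hj
    rw [hB j (by omega) (by omega), if_neg (by omega), if_neg (by omega), if_neg (by omega)]
  · rw [hB _ (by omega) (by omega), if_neg (by omega), if_neg (by omega), if_pos (by omega)]
  all_goals rw [Nat.card_Icc]; omega
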